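/- Let $\mathbb T=\mathbb R/2\pi\mathbb Z$, with Riemannian distance $d$, normalized Riemannian (Haar) probability measure $\lambda$ and natural derivative $\partial$. For $x,y\in\mathbb T$ with $y\neq x+\pi$, $y\ne x$, let $t\mapsto\gamma(x,y,t)$, $t\in\mathbb R$, be the unit speed geodesic with $\gamma(x,y,0)=x$ that is minimal from $x$ to $y=\gamma(x,y,d(x,y))$; for $y=x+\pi$ (and, as a convention, for $y=x$) take the anti-clockwise unit speed geodesic. Let $p\ge 1$. For a probability measure $\nu$ on $\mathbb T$ put $$U_p(x)=\int d(x,y)^p\,\nu(dy),\qquad \mu_\beta(dx)=\frac{e^{-\beta U_p(x)}\,\lambda(dx)}{\int e^{-\beta U_p}\,d\lambda},$$ and, for $\alpha>0$, $\beta\ge 0$ and $f\in C^2(\mathbb T)$, $$L_{\alpha,\beta}[f](x)=\tfrac12\,\partial^2 f(x)+\frac1\alpha\int \Bigl(f\bigl(\gamma(x,y,\tfrac p2\,\beta\alpha\, d(x,y)^{p-1})\bigr)-f(x)\Bigr)\,\nu(dy).$$ Let $\tilde a(p)=1$ if $p=1$ or $p\ge 3/2$, and $\tilde a(p)=2(p-1)$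 if $p\in(1,3/2)$. **Lemma.** For every $p\ge1$ there is a constant $\tilde\sigma(p)\in(0,1/2)$, and for every $p\geq 1$ and $A>0$ there is a constant $c_3=c_3(p,A)>0$, such that the following holds. Let $a\in(0,1]$ and let $\nu$ be a probability measure on $\mathbb T$ that has a density with respect to $\lambda$, also denoted $\nu$, with $|\nu(y)-\nu(x)|\le A\,d(x,y)^a$ for all $x,y\in\mathbb T$. Then for all $\alpha>0$ and $\beta\ge1$ with $\alpha\beta^2\le\tilde\sigma(p)$ and every $f\in C^2(\mathbb T)$, the function $L_{\alpha,\beta}[f-1](f-1)$ is $\mu_\beta$-integrable and $$\int L_{\alpha,\beta}[f-1]\,(f-1)\,d\mu_\beta\le-\Bigl(\tfrac12-c_3\,\alpha^{\tilde a(p)}\beta^3\Bigr)\int(\partial f)^2\,d\mu_\beta+c_3\,\alpha^{\tilde a(p)}\beta^3\int(f-1)^2\,d\mu_\beta .$$ -/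

import Mathlib

open MeasureTheory

namespace CircleMeans

noncomputable section

instance instFactTwoPiPos : Fact ((0 : ℝ) < 2 * Real.pi) := ⟨Real.two_pi_pos⟩

/-- The circle `ℝ / 2πℤ`; its norm distance `dist` is the Riemannian (arc length) distance. -/
abbrev Torus : Type := AddCircle (2 * Real.pi)

/-- The normalized Riemannian measure `λ`, a probability measure. -/
def lam : Measure Torus := AddCircle.haarAddCircle

/-- The representative of `y - x` in `(-π, π]`. -/
def angle (x y : Torus) : ℝ := (AddCircle.equivIoc (2 * Real.pi) (-Real.pi) (y - x) : ℝ)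

/-- The direction (`+1` anti-clockwise, `-1` clockwise) in which the minimal geodesic from `x` to
`y` starts. At the cut-locus `y = x + π` the anti-clockwise geodesic is chosen (and also for
`y = x`, where the direction is only a convention). -/
def direction (x y : Torus) : ℝ := if 0 ≤ angle x y then 1 else -1

/-- The point reached at time `t` by the unit speed geodesic that starts at `x`, is minimal
from `x` to `y`, and is continued for all times. -/
def geodesic (x y : Torus) (t : ℝ) : Torus := x + ((t * direction x y : ℝ) : Torus)

theorem geodesic_zero (x y : Torus) : geodesic x y 0 = x := by
  simp [geodesic]

theorem geodesic_dist (x y : Torus) : geodesic x y (dist x y) = y := by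
  have hπ := Real.pi_pos
  have hmem := (AddCircle.equivIoc (2 * Real.pi) (-Real.pi) (y - x)).2
  have hcoe : ((angle x y : ℝ) : Torus) = y - x := AddCircle.coe_equivIoc
  have hle : |angle x y| ≤ Real.pi := by
    rw [abs_le]
    constructor
    · exact hmem.1.le
    · have h2 := hmem.2
      unfold angle
      linarith
  have hd : dist x y = |angle x y| := by
    rw [dist_comm, dist_eq_norm, ← hcoe]
    refine (AddCircle.norm_coe_eq_abs_iff (p := 2 * Real.pi) (by positivity)).2 ?_
    rw [abs_of_pos Real.two_pi_pos]
    linarith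
  have hm : dist x y * direction x y = angle x y := by
    rw [hd]
    unfold direction
    split_ifs with h
    · rw [abs_of_nonneg h, mul_one]
    · rw [abs_of_neg (not_le.1 h)]
      ring
  rw [geodesic, hm, hcoe, add_sub_cancel]

/-- The natural derivative `∂` of a function on the circle. -/
def circleDeriv (f : Torus → ℝ) (x : Torus) : ℝ := deriv (fun t : ℝ => f (x + (t : Torus))) 0

/-- `f ∈ C²(𝕋)`: the `2π`-periodic lift of `f` to `ℝ` is `C²`. -/
def IsC2 (f : Torus → ℝ) : Prop := ContDiff ℝ 2 (fun t : ℝ => f (t : Torus))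

/-- The potential `U_p(x) = ∫ d(x,y)^p ν(dy)`. -/
def potential (ν : Measure Torus) (p : ℝ) (x : Torus) : ℝ := ∫ y, dist x y ^ p ∂ν

/-- The Gibbs probability measure `μ_β(dx) = Z⁻¹ exp(-β U_p(x)) λ(dx)`. -/
def gibbs (ν : Measure Torus) (p β : ℝ) : Measure Torus :=
  lam.tilted (fun x => -β * potential ν p x)

/-- The generator `L_{α,β}`. -/
def generator (ν : Measure Torus) (p α β : ℝ) (f : Torus → ℝ) (x : Torus) : ℝ :=
  (1 / 2) * circleDeriv (circleDeriv f) x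
    + (1 / α) * ∫ y, (f (geodesic x y ((p / 2) * β * α * dist x y ^ (p - 1))) - f x) ∂ν

/-- The exponent `ã(p)` (meaningful for `p ≥ 1`). -/
def aTilde (p : ℝ) : ℝ := if p = 1 ∨ 3 / 2 ≤ p then 1 else 2 * (p - 1)

end

end CircleMeans

open CircleMeans

/-!
Integrate over the starting point `x` of a jump before its target `y`. To first order in its
length, a jump of the generator moves `x` by `p β α / 2 * d(x,y)^(p-1)` towards `y`, and averaging
over `y` gives the drift `-β U' / 2`. Together with `f'' / 2` it forms an operator that is symmetric
for the Gibbs measure and has Dirichlet form `½ ∫ (∂f)²`.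

The second-order Taylor remainder involves an increment of `f'` along the jump, whereas only `f` and
`f'` may appear in the estimate. Parametrize each of the two arcs from `y` to its antipode by the
distance `θ` to `y`. The jump is then `θ ↦ θ - τ θ` with `τ θ = c θ^(p-1)`, and integrating by parts
in `θ` turns the increment of `f'` into increments of `f`. The derivative `τ'` may be unbounded at
`0`, but `τ` is monotone, so `τ'` has integral at most `sup τ`. Since `τ`, like the increments of
`f`, has size `αβ` and the Gibbs weight has logarithmic derivative of size `β`, the remainder is of
order `(αβ)² β / α = αβ³` for every `p ≥ 1`.
-/

open Set Filter Topology
open scoped NNReal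

namespace CircleMeans

instance : IsProbabilityMeasure lam :=
  inferInstanceAs (IsProbabilityMeasure AddCircle.haarAddCircle)

instance : lam.IsAddLeftInvariant :=
  inferInstanceAs (Measure.IsAddLeftInvariant AddCircle.haarAddCircle)

theorem continuous_of_continuous_lift {f : Torus → ℝ} (hf : Continuous fun t : ℝ => f (t : Torus)) :
    Continuous f :=
  (QuotientAddGroup.isQuotientMap_mk _).continuous_iff.2 hf

theorem continuous_of_continuousAt_add {f : Torus → ℝ}
    (hf : ∀ x : Torus, ContinuousAt (fun t : ℝ => f (x + (t : Torus))) 0) : Continuous f := by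
  refine continuous_of_continuous_lift (continuous_iff_continuousAt.2 fun t => ?_)
  have hsub : ContinuousAt (fun s : ℝ => s - t) t := by fun_prop
  have hcomp := ContinuousAt.comp_of_eq (hf t) hsub (sub_self t)
  simpa only [Function.comp_def, ← AddCircle.coe_add, add_sub_cancel] using hcomp

theorem integrable_of_continuous {f : Torus → ℝ} {μ : Measure Torus} [IsFiniteMeasure μ]
    (hf : Continuous f) : Integrable f μ :=
  hf.integrable_of_hasCompactSupport (HasCompactSupport.of_compactSpace _)

theorem integral_lam (f : Torus → ℝ) (t : ℝ) :
    ∫ x, f x ∂lam = (2 * Real.pi)⁻¹ * ∫ s in t..t + 2 * Real.pi, f (s : Torus) := by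
  rw [lam, AddCircle.integral_haarAddCircle, ← AddCircle.intervalIntegral_preimage _ t, smul_eq_mul]

/-- `h` is the derivative of `g` along the rotation flow of the circle. Unlike `circleDeriv`, this
asserts differentiability. -/
def HasCircleDeriv (g h : Torus → ℝ) : Prop :=
  ∀ x : Torus, HasDerivAt (fun t : ℝ => g (x + (t : Torus))) (h x) 0

namespace HasCircleDeriv

variable {g h k l : Torus → ℝ}

theorem comp_hasDerivAt (hg : HasCircleDeriv g h) (x : Torus) {s : ℝ → ℝ} {s' θ : ℝ}
    (hs : HasDerivAt s s' θ) :
    HasDerivAt (fun t : ℝ => g (x + (s t : Torus))) (h (x + (s θ : Torus)) * s') θ := by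
  have hzero : HasDerivAt (fun t : ℝ => g (x + (s θ : Torus) + (t : Torus)))
      (h (x + (s θ : Torus))) (s θ - s θ) := by
    simpa only [sub_self] using hg (x + (s θ : Torus))
  have hcomp := HasDerivAt.comp θ hzero (hs.sub_const (s θ))
  refine hcomp.congr_of_eventuallyEq (Eventually.of_forall fun t => ?_)
  simp only [Function.comp_apply, add_assoc, ← AddCircle.coe_add, add_sub_cancel]

theorem hasDerivAt (hg : HasCircleDeriv g h) (x : Torus) (t : ℝ) :
    HasDerivAt (fun t : ℝ => g (x + (t : Torus))) (h (x + (t : Torus))) t := by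
  simpa only [id_eq, mul_one] using hg.comp_hasDerivAt x (hasDerivAt_id t)

theorem continuous (hg : HasCircleDeriv g h) : Continuous g :=
  continuous_of_continuousAt_add fun x => (hg x).continuousAt

theorem mul (hg : HasCircleDeriv g h) (hk : HasCircleDeriv k l) :
    HasCircleDeriv (fun x => g x * k x) (fun x => h x * k x + g x * l x) := fun x => by
  simpa only [AddCircle.coe_zero, add_zero] using (hg x).fun_mul (hk x)

theorem exp_const_mul (hg : HasCircleDeriv g h) (c : ℝ) :
    HasCircleDeriv (fun x => Real.exp (c * g x))
      (fun x => c * h x * Real.exp (c * g x)) := fun x => by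
  simpa only [AddCircle.coe_zero, add_zero, mul_comm] using ((hg x).const_mul c).exp

theorem integral_eq_zero (hg : HasCircleDeriv g h) (hh : Continuous h) : ∫ x, h x ∂lam = 0 := by
  have hderiv : ∀ t : ℝ, HasDerivAt (fun t : ℝ => g (t : Torus)) (h (t : Torus)) t := fun t => by
    simpa only [zero_add] using hg.hasDerivAt 0 t
  have hcont : Continuous fun t : ℝ => h (t : Torus) :=
    hh.comp (AddCircle.continuous_mk' (2 * Real.pi))
  rw [integral_lam h 0, intervalIntegral.integral_eq_sub_of_hasDerivAt (fun t _ => hderiv t)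
    (hcont.intervalIntegrable _ _), AddCircle.coe_add_period, sub_self, mul_zero]

theorem sub_eq_intervalIntegral (hg : HasCircleDeriv g h) (hh : Continuous h) (x : Torus) (s : ℝ) :
    g (x + (s : Torus)) - g x = ∫ u in (0 : ℝ)..1, s * h (x + ((u * s : ℝ) : Torus)) := by
  have hcont : Continuous fun u : ℝ => s * h (x + ((u * s : ℝ) : Torus)) := by
    have := AddCircle.continuous_mk' (2 * Real.pi)
    fun_prop
  rw [intervalIntegral.integral_eq_sub_of_hasDerivAt
    (f := fun u : ℝ => g (x + ((u * s : ℝ) : Torus)))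
    (fun u _ => ?_) (hcont.intervalIntegrable _ _)]
  · simp only [one_mul, zero_mul, AddCircle.coe_zero, add_zero]
  · simpa only [id_eq, one_mul, mul_comm s] using
      hg.comp_hasDerivAt x ((hasDerivAt_id u).mul_const s)

end HasCircleDeriv

theorem circleDeriv_coe (f : Torus → ℝ) (t : ℝ) :
    circleDeriv f (t : Torus) = deriv (fun s : ℝ => f (s : Torus)) t := by
  simp only [circleDeriv, ← AddCircle.coe_add]
  rw [deriv_comp_const_add (f := fun s : ℝ => f (s : Torus)), add_zero]

theorem circleDeriv_sub_const (f : Torus → ℝ) (c : ℝ) :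
    circleDeriv (fun x => f x - c) = circleDeriv f :=
  funext fun _ => deriv_sub_const c

theorem hasCircleDeriv_circleDeriv {f : Torus → ℝ}
    (hf : Differentiable ℝ fun t : ℝ => f (t : Torus)) : HasCircleDeriv f (circleDeriv f) := by
  intro x
  obtain ⟨t, rfl⟩ := QuotientAddGroup.mk_surjective x
  refine DifferentiableAt.hasDerivAt ?_
  have := (hf (t + 0)).comp (0 : ℝ) (differentiableAt_id.const_add t)
  simpa only [Function.comp_def, id_eq, AddCircle.coe_add] using this

namespace IsC2

variable {f : Torus → ℝ}

theorem contDiff_lift_circleDeriv (hf : IsC2 f) :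
    ContDiff ℝ 1 fun t : ℝ => circleDeriv f (t : Torus) := by
  simp only [circleDeriv_coe]
  exact ((contDiff_succ_iff_deriv (n := 1)).1 hf).2.2

theorem sub_const (hf : IsC2 f) (c : ℝ) : IsC2 fun x => f x - c :=
  ContDiff.sub hf contDiff_const

theorem hasCircleDeriv (hf : IsC2 f) : HasCircleDeriv f (circleDeriv f) :=
  hasCircleDeriv_circleDeriv (hf.differentiable two_ne_zero)

theorem hasCircleDeriv_circleDeriv (hf : IsC2 f) :
    HasCircleDeriv (circleDeriv f) (circleDeriv (circleDeriv f)) :=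
  CircleMeans.hasCircleDeriv_circleDeriv (hf.contDiff_lift_circleDeriv.differentiable one_ne_zero)

theorem continuous_circleDeriv_circleDeriv (hf : IsC2 f) :
    Continuous (circleDeriv (circleDeriv f)) := by
  refine continuous_of_continuous_lift ?_
  simp only [circleDeriv_coe (circleDeriv f)]
  exact hf.contDiff_lift_circleDeriv.continuous_deriv le_rfl

end IsC2

section Fubini

variable {X : Type*} [TopologicalSpace X] [CompactSpace X] [SecondCountableTopology X]
  [MeasurableSpace X] [OpensMeasurableSpace X] {μ : Measure X} [IsFiniteMeasure μ]
  {q : ℝ → ℝ} {k : ℝ → X → ℝ} {a b : ℝ}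

theorem integrable_mul_of_continuous (hk : Continuous (Function.uncurry k))
    (hq : IntervalIntegrable q volume a b) :
    Integrable (Function.uncurry fun t x => q t * k t x)
      ((volume.restrict (uIoc a b)).prod μ) := by
  obtain ⟨C, hC⟩ := (isCompact_uIcc.prod isCompact_univ).exists_bound_of_continuousOn
    (s := uIcc a b ×ˢ (univ : Set X)) hk.continuousOn
  have hmem : ∀ᵐ z ∂(volume.restrict (uIoc a b)).prod μ, z.1 ∈ uIoc a b :=
    Measure.quasiMeasurePreserving_fst.ae (ae_restrict_mem measurableSet_uIoc)
  exact (hq.def'.comp_fst μ).mul_bdd (c := C) hk.aestronglyMeasurable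
    (hmem.mono fun z hz => hC z ⟨uIoc_subset_uIcc hz, mem_univ _⟩)

theorem integrable_intervalIntegral_mul (hab : a ≤ b) (hk : Continuous (Function.uncurry k))
    (hq : IntervalIntegrable q volume a b) : Integrable (fun x => ∫ t in a..b, q t * k t x) μ := by
  have hint := integrable_mul_of_continuous (μ := μ) hk hq
  rw [uIoc_of_le hab] at hint
  simpa only [intervalIntegral.integral_of_le hab, Function.uncurry] using hint.integral_prod_right

theorem integral_intervalIntegral_mul_le (hab : a ≤ b) (hk : Continuous (Function.uncurry k))
    (hq : IntervalIntegrable q volume a b) (hq0 : ∀ t ∈ Ioo a b, 0 ≤ q t) {κ : ℝ}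
    (hκ : ∀ t ∈ Icc a b, ∫ x, k t x ∂μ ≤ κ) :
    ∫ x, (∫ t in a..b, q t * k t x) ∂μ ≤ (∫ t in a..b, q t) * κ := by
  have hint := integrable_mul_of_continuous (μ := μ) hk hq
  rw [← intervalIntegral_integral_swap hint, ← intervalIntegral.integral_mul_const]
  refine intervalIntegral.integral_mono_on_of_le_Ioo hab
    (intervalIntegrable_iff.2 hint.integral_prod_left) (hq.mul_const κ) fun t ht => ?_
  rw [integral_const_mul]
  exact mul_le_mul_of_nonneg_left (hκ t (Ioo_subset_Icc_self ht)) (hq0 t ht)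

end Fubini

/-- A positive `C¹` weight on the circle whose logarithmic derivative is bounded by `K`; for
instance an unnormalized Gibbs density `exp (-β U)` with `K = β * sup |U'|`. -/
structure IsWeight (m m' : Torus → ℝ) (K : ℝ) : Prop where
  hasCircleDeriv : HasCircleDeriv m m'
  continuous_deriv : Continuous m'
  pos : ∀ x, 0 < m x
  abs_deriv_le : ∀ x, |m' x| ≤ K * m x

/-- The weighted `H¹` energy `∫ h² m dλ + ∫ g² m dλ` of a function `g` with derivative `h`. -/
noncomputable def energy (g h m : Torus → ℝ) : ℝ :=
  ∫ x, h x ^ 2 * m x ∂lam + ∫ x, g x ^ 2 * m x ∂lam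

theorem energy_nonneg (g h : Torus → ℝ) {m : Torus → ℝ} (hm : ∀ x, 0 ≤ m x) :
    0 ≤ energy g h m :=
  add_nonneg (integral_nonneg fun x => mul_nonneg (sq_nonneg _) (hm x))
    (integral_nonneg fun x => mul_nonneg (sq_nonneg _) (hm x))

namespace IsWeight

variable {m m' g h : Torus → ℝ} {K S s : ℝ}

theorem nonneg_const (hw : IsWeight m m' K) : 0 ≤ K :=
  nonneg_of_mul_nonneg_left ((abs_nonneg _).trans (hw.abs_deriv_le 0)) (hw.pos 0)

theorem continuous (hw : IsWeight m m' K) : Continuous m :=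
  hw.hasCircleDeriv.continuous

theorem le_exp_mul (hw : IsWeight m m' K) (hs : |s| ≤ S) (x : Torus) :
    m x ≤ Real.exp (K * S) * m (x + (s : Torus)) := by
  have hderiv : ∀ t : ℝ, HasDerivAt
      (fun t : ℝ => Real.exp (K * |s| * t) * m (x + ((t * s : ℝ) : Torus)))
      (Real.exp (K * |s| * t) *
        (K * |s| * m (x + ((t * s : ℝ) : Torus)) + s * m' (x + ((t * s : ℝ) : Torus)))) t :=
    fun t => by
      have hexp := ((hasDerivAt_id t).const_mul (K * |s|)).exp
      have hm := hw.hasCircleDeriv.comp_hasDerivAt x ((hasDerivAt_id t).mul_const s)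
      refine (hexp.fun_mul hm).congr_deriv ?_
      simp only [id_eq]
      ring
  have hmono : Monotone fun t : ℝ => Real.exp (K * |s| * t) * m (x + ((t * s : ℝ) : Torus)) := by
    refine monotone_of_deriv_nonneg (fun t => (hderiv t).differentiableAt) fun t => ?_
    rw [(hderiv t).deriv]
    have hprod : |s * m' (x + ((t * s : ℝ) : Torus))| ≤
        |s| * (K * m (x + ((t * s : ℝ) : Torus))) := by
      rw [abs_mul]
      exact mul_le_mul_of_nonneg_left (hw.abs_deriv_le _) (abs_nonneg s)
    have := neg_le_of_abs_le hprod
    exact mul_nonneg (Real.exp_nonneg _) (by linarith)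
  calc m x ≤ Real.exp (K * |s|) * m (x + (s : Torus)) := by
        simpa using hmono zero_le_one
    _ ≤ Real.exp (K * S) * m (x + (s : Torus)) := by
        have := hw.nonneg_const
        have := (hw.pos (x + (s : Torus))).le
        gcongr

theorem one_le_exp (hw : IsWeight m m' K) (hs : |s| ≤ S) : 1 ≤ Real.exp (K * S) :=
  Real.one_le_exp (mul_nonneg hw.nonneg_const ((abs_nonneg s).trans hs))

theorem integral_abs_shift_mul_le (hw : IsWeight m m' K) (hg : Continuous g) (hh : Continuous h)
    (hs : |s| ≤ S) :
    ∫ x, |h (x + (s : Torus))| * (|g x| * m x) ∂lam ≤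
      Real.exp (K * S) / 2 * (∫ x, h x ^ 2 * m x ∂lam + ∫ x, g x ^ 2 * m x ∂lam) := by
  have hm := hw.continuous
  set E := Real.exp (K * S)
  have hpoint : ∀ x, |h (x + (s : Torus))| * (|g x| * m x) ≤
      E / 2 * (h (x + (s : Torus)) ^ 2 * m (x + (s : Torus)) + g x ^ 2 * m x) := fun x => by
    have hamgm := two_mul_le_add_sq |h (x + (s : Torus))| |g x|
    rw [sq_abs, sq_abs] at hamgm
    have hfst := mul_le_mul_of_nonneg_left (hw.le_exp_mul hs x) (sq_nonneg (h (x + (s : Torus))))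
    have hsnd := mul_le_mul_of_nonneg_right (hw.one_le_exp hs)
      (mul_nonneg (sq_nonneg (g x)) (hw.pos x).le)
    have hmul := mul_le_mul_of_nonneg_right hamgm (hw.pos x).le
    linarith
  have hshift : ∫ x, h (x + (s : Torus)) ^ 2 * m (x + (s : Torus)) ∂lam = ∫ x, h x ^ 2 * m x ∂lam :=
    integral_add_right_eq_self (fun x => h x ^ 2 * m x) (s : Torus)
  rw [← hshift, ← integral_add (integrable_of_continuous (by fun_prop))
    (integrable_of_continuous (by fun_prop)), ← integral_const_mul]
  exact integral_mono (integrable_of_continuous (by fun_prop))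
    (integrable_of_continuous (by fun_prop)) hpoint

theorem integral_abs_increment_mul_le (hw : IsWeight m m' K) {k : Torus → ℝ}
    (hg : HasCircleDeriv g h) (hh : Continuous h) (hk : Continuous k) (hs : |s| ≤ S) :
    ∫ x, |g (x + (s : Torus)) - g x| * (|k x| * m x) ∂lam ≤
      |s| * (Real.exp (K * S) / 2 * (∫ x, h x ^ 2 * m x ∂lam + ∫ x, k x ^ 2 * m x ∂lam)) := by
  have hm := hw.continuous
  have hgc := hg.continuous
  have := AddCircle.continuous_mk' (2 * Real.pi)
  have hjoint : Continuous (Function.uncurry fun (u : ℝ) (x : Torus) =>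
      |h (x + ((u * s : ℝ) : Torus))| * (|k x| * m x)) := by
    fun_prop
  have hpoint : ∀ x, |g (x + (s : Torus)) - g x| * (|k x| * m x) ≤
      ∫ u in (0 : ℝ)..1, |s| * (|h (x + ((u * s : ℝ) : Torus))| * (|k x| * m x)) := fun x => by
    have habs : |g (x + (s : Torus)) - g x| ≤
        ∫ u in (0 : ℝ)..1, |s * h (x + ((u * s : ℝ) : Torus))| := by
      rw [hg.sub_eq_intervalIntegral hh]
      exact intervalIntegral.abs_integral_le_integral_abs zero_le_one
    refine (mul_le_mul_of_nonneg_right habs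
      (mul_nonneg (abs_nonneg _) (hw.pos x).le)).trans_eq ?_
    simp only [← intervalIntegral.integral_mul_const, abs_mul, mul_assoc]
  have hint : Integrable (fun x => ∫ u in (0 : ℝ)..1,
      |s| * (|h (x + ((u * s : ℝ) : Torus))| * (|k x| * m x))) lam :=
    integrable_of_continuous <|
      intervalIntegral.continuous_parametric_intervalIntegral_of_continuous' (by fun_prop) _ _
  refine (integral_mono (integrable_of_continuous (by fun_prop)) hint hpoint).trans ?_
  have hfubini := integral_intervalIntegral_mul_le (μ := lam) zero_le_one hjoint
    (intervalIntegrable_const (c := |s|)) (fun _ _ => abs_nonneg s) fun u hu =>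
      hw.integral_abs_shift_mul_le hk hh (s := u * s) (S := S) ?_
  · simpa only [intervalIntegral.integral_const, sub_zero, one_smul] using hfubini
  · rw [abs_mul, abs_of_nonneg hu.1]
    exact (mul_le_of_le_one_left (abs_nonneg s) hu.2).trans hs

theorem integral_abs_shift_deriv_mul_le (hw : IsWeight m m' K) (hg : HasCircleDeriv g h)
    (hh : Continuous h) (hs : |s| ≤ S) :
    ∫ x, |h (x + (s : Torus)) * (g x * m x)| ∂lam ≤ Real.exp (K * S) / 2 * energy g h m := by
  simpa only [abs_mul, abs_of_pos (hw.pos _), energy] using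
    hw.integral_abs_shift_mul_le hg.continuous hh hs

theorem integral_abs_increment_mul_self_le (hw : IsWeight m m' K) (hg : HasCircleDeriv g h)
    (hh : Continuous h) (hs : |s| ≤ S) :
    ∫ x, |(g (x + (s : Torus)) - g x) * (g x * m x)| ∂lam ≤
      S * (Real.exp (K * S) / 2 * energy g h m) := by
  have hbound := hw.integral_abs_increment_mul_le hg hh hg.continuous hs
  have henergy := energy_nonneg g h fun x => (hw.pos x).le
  simp only [abs_mul, abs_of_pos (hw.pos _)]
  exact hbound.trans (mul_le_mul_of_nonneg_right hs (mul_nonneg (by positivity) henergy))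

theorem integral_abs_increment_mul_deriv_le (hw : IsWeight m m' K) (hg : HasCircleDeriv g h)
    (hh : Continuous h) (hs : |s| ≤ S) :
    ∫ x, |(g (x + (s : Torus)) - g x) * (h x * m x + g x * m' x)| ∂lam ≤
      S * ((2 + K) * (Real.exp (K * S) / 2 * energy g h m)) := by
  have hm := hw.continuous
  have hm' := hw.continuous_deriv
  have hgc := hg.continuous
  have hpoint : ∀ x, |(g (x + (s : Torus)) - g x) * (h x * m x + g x * m' x)| ≤
      |g (x + (s : Torus)) - g x| * (|h x| * m x) +
        K * (|g (x + (s : Torus)) - g x| * (|g x| * m x)) := fun x => by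
    have hsum : |h x * m x + g x * m' x| ≤ |h x| * m x + K * (|g x| * m x) := by
      refine (abs_add_le _ _).trans ?_
      rw [abs_mul, abs_mul, abs_of_pos (hw.pos x), ← mul_left_comm]
      gcongr
      exact hw.abs_deriv_le x
    rw [abs_mul]
    exact (mul_le_mul_of_nonneg_left hsum (abs_nonneg _)).trans_eq (by ring)
  have hfst := hw.integral_abs_increment_mul_le hg hh hh hs
  have hsnd := hw.integral_abs_increment_mul_le hg hh hgc hs
  have hK := hw.nonneg_const
  have hg0 : 0 ≤ ∫ x, g x ^ 2 * m x ∂lam :=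
    integral_nonneg fun x => mul_nonneg (sq_nonneg _) (hw.pos x).le
  have henergy := energy_nonneg g h fun x => (hw.pos x).le
  calc ∫ x, |(g (x + (s : Torus)) - g x) * (h x * m x + g x * m' x)| ∂lam
      ≤ ∫ x, |g (x + (s : Torus)) - g x| * (|h x| * m x) ∂lam +
          K * ∫ x, |g (x + (s : Torus)) - g x| * (|g x| * m x) ∂lam := by
        rw [← integral_const_mul, ← integral_add (integrable_of_continuous (by fun_prop))
          (integrable_of_continuous (by fun_prop))]
        exact integral_mono (integrable_of_continuous (by fun_prop))
          (integrable_of_continuous (by fun_prop)) hpoint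
    _ ≤ |s| * (Real.exp (K * S) / 2 * (2 * energy g h m)) +
          K * (|s| * (Real.exp (K * S) / 2 * energy g h m)) := by
        refine add_le_add (hfst.trans ?_) (mul_le_mul_of_nonneg_left hsnd hK)
        rw [energy]
        gcongr
        linarith
    _ = |s| * ((2 + K) * (Real.exp (K * S) / 2 * energy g h m)) := by ring
    _ ≤ S * ((2 + K) * (Real.exp (K * S) / 2 * energy g h m)) :=
        mul_le_mul_of_nonneg_right hs
          (mul_nonneg (by positivity) (mul_nonneg (by positivity) henergy))

end IsWeight

/-- The lengths `τ θ ≤ S` of the steps taken by points at distance `θ ∈ [0, b]` from their target,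
nondecreasing in `θ` with derivative `τ'`. At `0`, where `θ ^ (p - 1)` need not be differentiable,
only continuity is required. -/
structure IsStepProfile (τ τ' : ℝ → ℝ) (b S : ℝ) : Prop where
  nonneg_length : 0 ≤ b
  continuous : Continuous τ
  mem_Icc : ∀ θ ∈ Icc 0 b, τ θ ∈ Icc 0 S
  hasDerivAt : ∀ θ ∈ Ioc 0 b, HasDerivAt τ (τ' θ) θ
  deriv_nonneg : ∀ θ ∈ Ioc 0 b, 0 ≤ τ' θ

namespace IsStepProfile

variable {τ τ' k k' w w' : ℝ → ℝ} {b u S : ℝ}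

theorem nonneg_bound (hτ : IsStepProfile τ τ' b S) : 0 ≤ S :=
  (hτ.mem_Icc 0 (left_mem_Icc.2 hτ.nonneg_length)).1.trans
    (hτ.mem_Icc 0 (left_mem_Icc.2 hτ.nonneg_length)).2

theorem integral_mul_le (hτ : IsStepProfile τ τ' b S) {θ κ : ℝ} (hθ : θ ∈ Icc 0 b) {F : Torus → ℝ}
    (hκ : 0 ≤ κ) (hF : ∫ y, F y ∂lam ≤ κ) : ∫ y, τ θ * F y ∂lam ≤ S * κ := by
  rw [integral_const_mul]
  exact (mul_le_mul_of_nonneg_left hF (hτ.mem_Icc θ hθ).1).trans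
    (mul_le_mul_of_nonneg_right (hτ.mem_Icc θ hθ).2 hκ)

theorem intervalIntegrable_deriv (hτ : IsStepProfile τ τ' b S) :
    IntervalIntegrable τ' volume 0 b := by
  refine intervalIntegral.intervalIntegrable_deriv_of_nonneg hτ.continuous.continuousOn ?_ ?_ <;>
    rw [min_eq_left hτ.nonneg_length, max_eq_right hτ.nonneg_length] <;> intro θ hθ
  · exact hτ.hasDerivAt θ (Ioo_subset_Ioc_self hθ)
  · exact hτ.deriv_nonneg θ (Ioo_subset_Ioc_self hθ)

theorem integral_deriv_le (hτ : IsStepProfile τ τ' b S) : ∫ θ in 0..b, τ' θ ≤ S := by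
  rw [intervalIntegral.integral_eq_sub_of_hasDerivAt_of_le hτ.nonneg_length
    hτ.continuous.continuousOn (fun θ hθ => hτ.hasDerivAt θ (Ioo_subset_Ioc_self hθ))
    hτ.intervalIntegrable_deriv]
  linarith [(hτ.mem_Icc 0 (left_mem_Icc.2 hτ.nonneg_length)).1,
    (hτ.mem_Icc b (right_mem_Icc.2 hτ.nonneg_length)).2]

theorem integral_le (hτ : IsStepProfile τ τ' b S) : ∫ θ in 0..b, τ θ ≤ b * S := by
  refine (intervalIntegral.integral_mono_on hτ.nonneg_length (hτ.continuous.intervalIntegrable 0 b)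
    intervalIntegrable_const fun θ hθ => (hτ.mem_Icc θ hθ).2).trans_eq ?_
  rw [intervalIntegral.integral_const, sub_zero, smul_eq_mul]

/-- The increment `D θ = k (θ - u τ) - k θ` has derivative
`k' (θ - u τ) - k' θ - u τ' k' (θ - u τ)`, so an integration by parts trades
the increment of `k'` for increments of `k`. -/
theorem integral_mul_increment_eq (hτ : IsStepProfile τ τ' b S)
    (hk : ∀ θ, HasDerivAt k (k' θ) θ) (hk' : Continuous k')
    (hw : ∀ θ, HasDerivAt w (w' θ) θ) (hw' : Continuous w') :
    ∫ θ in 0..b, τ θ * (k' (θ - u * τ θ) - k' θ) * w θ =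
      τ b * ((k (b - u * τ b) - k b) * w b) - τ 0 * ((k (0 - u * τ 0) - k 0) * w 0)
        - ∫ θ in 0..b, (τ' θ * ((k (θ - u * τ θ) - k θ) * w θ
              - u * (τ θ * (k' (θ - u * τ θ) * w θ)))
            + τ θ * ((k (θ - u * τ θ) - k θ) * w' θ)) := by
  have hkc : Continuous k := continuous_iff_continuousAt.2 fun θ => (hk θ).continuousAt
  have hwc : Continuous w := continuous_iff_continuousAt.2 fun θ => (hw θ).continuousAt
  have hτc := hτ.continuous
  have hlhs : IntervalIntegrable (fun θ => τ θ * (k' (θ - u * τ θ) - k' θ) * w θ) volume 0 b :=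
    Continuous.intervalIntegrable (by fun_prop) _ _
  have hrhs : IntervalIntegrable (fun θ => τ' θ * ((k (θ - u * τ θ) - k θ) * w θ
      - u * (τ θ * (k' (θ - u * τ θ) * w θ))) + τ θ * ((k (θ - u * τ θ) - k θ) * w' θ))
      volume 0 b :=
    (hτ.intervalIntegrable_deriv.mul_continuousOn (by fun_prop)).add
      (Continuous.intervalIntegrable (by fun_prop) _ _)
  rw [eq_sub_iff_add_eq, ← intervalIntegral.integral_add hlhs hrhs]
  refine intervalIntegral.integral_eq_sub_of_hasDerivAt_of_le hτ.nonneg_length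
    (f := fun θ => τ θ * ((k (θ - u * τ θ) - k θ) * w θ)) (by fun_prop) (fun θ hθ => ?_)
    (hlhs.add hrhs)
  have hτθ := hτ.hasDerivAt θ (Ioo_subset_Ioc_self hθ)
  have hshift := (hk (θ - u * τ θ)).comp θ ((hasDerivAt_id θ).sub (hτθ.const_mul u))
  refine (hτθ.mul ((hshift.sub (hk θ)).mul (hw θ))).congr_deriv ?_
  simp only [Function.comp_apply, Pi.mul_apply, Pi.sub_apply, id_eq]
  ring

theorem abs_integral_mul_increment_le (hτ : IsStepProfile τ τ' b S)
    (hk : ∀ θ, HasDerivAt k (k' θ) θ) (hk' : Continuous k')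
    (hw : ∀ θ, HasDerivAt w (w' θ) θ) (hw' : Continuous w') (hu : u ∈ Icc (0 : ℝ) 1) :
    |∫ θ in 0..b, τ θ * (k' (θ - u * τ θ) - k' θ) * w θ| ≤
      τ b * |(k (b - u * τ b) - k b) * w b| + τ 0 * |(k (0 - u * τ 0) - k 0) * w 0|
        + ((∫ θ in 0..b, τ' θ * (|(k (θ - u * τ θ) - k θ) * w θ|
            + τ θ * |k' (θ - u * τ θ) * w θ|))
          + ∫ θ in 0..b, τ θ * |(k (θ - u * τ θ) - k θ) * w' θ|) := by
  have hkc : Continuous k := continuous_iff_continuousAt.2 fun θ => (hk θ).continuousAt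
  have hwc : Continuous w := continuous_iff_continuousAt.2 fun θ => (hw θ).continuousAt
  have hτc := hτ.continuous
  have hτ'int := hτ.intervalIntegrable_deriv
  have hfst : IntervalIntegrable (fun θ => τ' θ * (|(k (θ - u * τ θ) - k θ) * w θ|
      + τ θ * |k' (θ - u * τ θ) * w θ|)) volume 0 b := hτ'int.mul_continuousOn (by fun_prop)
  have hsnd : IntervalIntegrable (fun θ => τ θ * |(k (θ - u * τ θ) - k θ) * w' θ|) volume 0 b :=
    Continuous.intervalIntegrable (by fun_prop) _ _
  rw [hτ.integral_mul_increment_eq hk hk' hw hw',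
    ← intervalIntegral.integral_add hfst hsnd]
  refine (abs_sub _ _).trans (add_le_add ((abs_sub _ _).trans_eq ?_) ?_)
  · rw [abs_mul, abs_mul (τ 0), abs_of_nonneg (hτ.mem_Icc b (right_mem_Icc.2 hτ.nonneg_length)).1,
      abs_of_nonneg (hτ.mem_Icc 0 (left_mem_Icc.2 hτ.nonneg_length)).1]
  · rw [← Real.norm_eq_abs]
    refine intervalIntegral.norm_integral_le_of_norm_le hτ.nonneg_length (.of_forall fun θ hθ => ?_)
      (hfst.add hsnd)
    rw [Real.norm_eq_abs]
    have hτθ := (hτ.mem_Icc θ (Ioc_subset_Icc_self hθ)).1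
    have hdrift : |u * (τ θ * (k' (θ - u * τ θ) * w θ))| ≤ τ θ * |k' (θ - u * τ θ) * w θ| := by
      rw [abs_mul, abs_mul (τ θ), abs_of_nonneg hτθ, abs_of_nonneg hu.1]
      exact mul_le_of_le_one_left (by positivity) hu.2
    refine (abs_add_le _ _).trans (add_le_add ?_ ?_)
    · rw [abs_mul, abs_of_nonneg (hτ.deriv_nonneg θ hθ)]
      exact mul_le_mul_of_nonneg_left ((abs_sub _ _).trans (add_le_add_right hdrift _))
        (hτ.deriv_nonneg θ hθ)
    · rw [abs_mul, abs_of_nonneg hτθ]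

theorem integral_le_of_le_boundary_add_bulk (hτ : IsStepProfile τ τ' b S) {Φ : Torus → ℝ}
    {A B C : ℝ → Torus → ℝ} {κ₀ κ₁ : ℝ} (hΦ : Integrable Φ lam)
    (hA : Continuous (Function.uncurry A)) (hB : Continuous (Function.uncurry B))
    (hC : Continuous (Function.uncurry C)) (hκ₀ : 0 ≤ κ₀) (hκ₁ : 0 ≤ κ₁)
    (hAle : ∀ θ ∈ Icc 0 b, ∫ y, A θ y ∂lam ≤ S * κ₀)
    (hBle : ∀ θ ∈ Icc 0 b, ∫ y, B θ y ∂lam ≤ S * κ₁)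
    (hCle : ∀ θ ∈ Icc 0 b, ∫ y, C θ y ∂lam ≤ κ₀)
    (hle : ∀ y, Φ y ≤ τ b * A b y + τ 0 * A 0 y
      + ((∫ θ in 0..b, τ' θ * (A θ y + τ θ * C θ y)) + ∫ θ in 0..b, τ θ * B θ y)) :
    ∫ y, Φ y ∂lam ≤ S ^ 2 * (4 * κ₀ + b * κ₁) := by
  have hb := hτ.nonneg_length
  have hτc := hτ.continuous
  have hzero : (0 : ℝ) ∈ Icc 0 b := left_mem_Icc.2 hb
  have hbmem : b ∈ Icc 0 b := right_mem_Icc.2 hb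
  have hS := hτ.nonneg_bound
  have hsum : ∀ θ ∈ Icc 0 b, ∫ y, (A θ y + τ θ * C θ y) ∂lam ≤ S * κ₀ + S * κ₀ := fun θ hθ => by
    rw [integral_add (integrable_of_continuous (by fun_prop))
      (integrable_of_continuous (by fun_prop))]
    exact add_le_add (hAle θ hθ) (hτ.integral_mul_le hθ hκ₀ (hCle θ hθ))
  have hAC : Continuous (Function.uncurry fun θ y => A θ y + τ θ * C θ y) := by fun_prop
  have hτint := hτc.intervalIntegrable (μ := volume) 0 b
  have hfst := integral_intervalIntegral_mul_le (μ := lam) hb hAC hτ.intervalIntegrable_deriv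
    (fun θ hθ => hτ.deriv_nonneg θ (Ioo_subset_Ioc_self hθ)) hsum
  have hsnd := integral_intervalIntegral_mul_le (μ := lam) hb hB hτint
    (fun θ hθ => (hτ.mem_Icc θ (Ioo_subset_Icc_self hθ)).1) hBle
  have hfstint := integrable_intervalIntegral_mul (μ := lam) hb hAC hτ.intervalIntegrable_deriv
  have hsndint := integrable_intervalIntegral_mul (μ := lam) hb hB hτint
  have hAint : ∀ θ, Integrable (fun y => τ θ * A θ y) lam := fun θ =>
    integrable_of_continuous (by fun_prop)
  calc ∫ y, Φ y ∂lam
      ≤ (∫ y, τ b * A b y ∂lam + ∫ y, τ 0 * A 0 y ∂lam)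
          + (∫ y, (∫ θ in 0..b, τ' θ * (A θ y + τ θ * C θ y)) ∂lam
            + ∫ y, (∫ θ in 0..b, τ θ * B θ y) ∂lam) := by
        rw [← integral_add (hAint b) (hAint 0), ← integral_add hfstint hsndint,
          ← integral_add (by fun_prop) (by fun_prop)]
        exact integral_mono hΦ (by fun_prop) hle
    _ ≤ S * (S * κ₀) + S * (S * κ₀) + (S * (S * κ₀ + S * κ₀) + b * S * (S * κ₁)) :=
        add_le_add (add_le_add (hτ.integral_mul_le hbmem (by positivity) (hAle b hbmem))
          (hτ.integral_mul_le hzero (by positivity) (hAle 0 hzero))) (add_le_add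
          (hfst.trans (mul_le_mul_of_nonneg_right hτ.integral_deriv_le (by positivity)))
          (hsnd.trans (mul_le_mul_of_nonneg_right hτ.integral_le (by positivity))))
    _ = S ^ 2 * (4 * κ₀ + b * κ₁) := by ring

end IsStepProfile

/-- The integral of `T (h (x + u T) - h x) (g x) (m x)` along the arc `x = y + v θ`, `0 ≤ θ ≤ b`,
where the step `T = - v τ θ` points back to `y`. -/
noncomputable def transport (g h m : Torus → ℝ) (τ : ℝ → ℝ) (b v u : ℝ) (y : Torus) : ℝ :=
  ∫ θ in 0..b, -(v * τ θ) *
    (h (y + ((v * θ : ℝ) : Torus) + ((u * -(v * τ θ) : ℝ) : Torus)) - h (y + ((v * θ : ℝ) : Torus)))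
      * (g (y + ((v * θ : ℝ) : Torus)) * m (y + ((v * θ : ℝ) : Torus)))

section Transport

variable {τ τ' : ℝ → ℝ} {g h m m' : Torus → ℝ} {b K S u v : ℝ}

theorem continuous_transport (hg : Continuous g) (hh : Continuous h) (hm : Continuous m)
    (hτ : Continuous τ) (b v u : ℝ) : Continuous (transport g h m τ b v u) := by
  have := AddCircle.continuous_mk' (2 * Real.pi)
  exact intervalIntegral.continuous_parametric_intervalIntegral_of_continuous' (by fun_prop) _ _

theorem IsWeight.abs_transport_le (hw : IsWeight m m' K) (hg : HasCircleDeriv g h)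
    (hh : Continuous h) (hτ : IsStepProfile τ τ' b S) (hv : |v| = 1) (hu : u ∈ Icc (0 : ℝ) 1)
    (y : Torus) :
    let x : ℝ → Torus := fun θ => y + ((v * θ : ℝ) : Torus)
    let s : ℝ → Torus := fun θ => ((u * -(v * τ θ) : ℝ) : Torus)
    let A : ℝ → ℝ := fun θ => |(g (x θ + s θ) - g (x θ)) * (g (x θ) * m (x θ))|
    |transport g h m τ b v u y| ≤ τ b * A b + τ 0 * A 0
      + ((∫ θ in 0..b, τ' θ * (A θ + τ θ * |h (x θ + s θ) * (g (x θ) * m (x θ))|))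
        + ∫ θ in 0..b, τ θ *
            |(g (x θ + s θ) - g (x θ)) * (h (x θ) * m (x θ) + g (x θ) * m' (x θ))|) := by
  intro x s A
  have := AddCircle.continuous_mk' (2 * Real.pi)
  have hgc := hg.continuous
  have hm := hw.continuous
  have hm' := hw.continuous_deriv
  have harc : ∀ θ, HasDerivAt (fun θ : ℝ => v * θ) v θ := fun θ => by
    simpa using (hasDerivAt_id θ).const_mul v
  have hshift : ∀ θ : ℝ, y + ((v * (θ - u * τ θ) : ℝ) : Torus) = x θ + s θ := fun θ => by
    rw [add_assoc, ← AddCircle.coe_add]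
    congr 2
    ring
  have hbound := hτ.abs_integral_mul_increment_le
    (fun θ => hg.comp_hasDerivAt y (harc θ)) (by fun_prop)
    (fun θ => (hg.mul hw.hasCircleDeriv).comp_hasDerivAt y (harc θ)) (by fun_prop) hu
  simp only [hshift, abs_mul, hv, mul_one] at hbound
  have hneg : transport g h m τ b v u y = -∫ θ in 0..b,
      τ θ * (h (x θ + s θ) * v - h (x θ) * v) * (g (x θ) * m (x θ)) := by
    rw [transport, ← intervalIntegral.integral_neg]
    congr with θ
    ring
  rw [hneg, abs_neg]
  simpa only [A, abs_mul] using hbound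

theorem IsWeight.integral_abs_transport_le (hw : IsWeight m m' K) (hg : HasCircleDeriv g h)
    (hh : Continuous h) (hτ : IsStepProfile τ τ' b S) (hv : |v| = 1) (hu : u ∈ Icc (0 : ℝ) 1) :
    ∫ y, |transport g h m τ b v u y| ∂lam ≤
      S ^ 2 * ((4 + b * (2 + K)) * (Real.exp (K * S) / 2 * energy g h m)) := by
  have := AddCircle.continuous_mk' (2 * Real.pi)
  have hτc := hτ.continuous
  have hgc := hg.continuous
  have hm := hw.continuous
  have hm' := hw.continuous_deriv
  have hK := hw.nonneg_const
  have henergy := energy_nonneg g h fun x => (hw.pos x).le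
  have hs : ∀ θ ∈ Icc 0 b, |u * -(v * τ θ)| ≤ S := fun θ hθ => by
    rw [abs_mul, abs_neg, abs_mul, hv, one_mul, abs_of_nonneg hu.1,
      abs_of_nonneg (hτ.mem_Icc θ hθ).1]
    exact (mul_le_of_le_one_left (hτ.mem_Icc θ hθ).1 hu.2).trans (hτ.mem_Icc θ hθ).2
  have hrotate : ∀ (F : Torus → ℝ) (t : ℝ), ∫ y, F (y + (t : Torus)) ∂lam = ∫ x, F x ∂lam :=
    fun F t => integral_add_right_eq_self F (t : Torus)
  refine (hτ.integral_le_of_le_boundary_add_bulk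
    (integrable_of_continuous (continuous_transport hgc hh hm hτc b v u).abs)
    (by fun_prop) (by fun_prop) (by fun_prop) (by positivity) (by positivity)
    (fun θ hθ => (hrotate _ _).trans_le (hw.integral_abs_increment_mul_self_le hg hh (hs θ hθ)))
    (fun θ hθ => (hrotate _ _).trans_le (hw.integral_abs_increment_mul_deriv_le hg hh (hs θ hθ)))
    (fun θ hθ => (hrotate _ _).trans_le (hw.integral_abs_shift_deriv_mul_le hg hh (hs θ hθ)))
    (hw.abs_transport_le hg hh hτ hv hu)).trans_eq (by ring)

end Transport

section Angle

variable {x y : Torus} {θ : ℝ}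

theorem coe_angle (x y : Torus) : (angle x y : Torus) = y - x :=
  AddCircle.coe_equivIoc

theorem angle_mem_Ioc (x y : Torus) : angle x y ∈ Ioc (-Real.pi) Real.pi := by
  have hmem := (AddCircle.equivIoc (2 * Real.pi) (-Real.pi) (y - x)).2
  exact ⟨hmem.1, hmem.2.trans_eq (by ring)⟩

theorem angle_eq_of_sub_eq (h : y - x = (θ : Torus)) (hθ : θ ∈ Ioc (-Real.pi) Real.pi) :
    angle x y = θ := by
  rw [angle, h]
  exact AddCircle.equivIoc_coe_of_mem ⟨hθ.1, hθ.2.trans_eq (by ring)⟩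

theorem dist_eq_abs_angle (x y : Torus) : dist x y = |angle x y| := by
  have hle : |angle x y| ≤ Real.pi :=
    abs_le.2 ⟨(angle_mem_Ioc x y).1.le, (angle_mem_Ioc x y).2⟩
  rw [dist_comm, dist_eq_norm, ← coe_angle]
  refine (AddCircle.norm_coe_eq_abs_iff (p := 2 * Real.pi) Real.two_pi_pos.ne').2 ?_
  rw [abs_of_pos Real.two_pi_pos]
  linarith

theorem dist_le_pi (x y : Torus) : dist x y ≤ Real.pi := by
  rw [dist_eq_abs_angle]
  exact abs_le.2 ⟨(angle_mem_Ioc x y).1.le, (angle_mem_Ioc x y).2⟩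

theorem measurable_angle : Measurable (Function.uncurry angle) :=
  measurable_subtype_coe.comp
    ((AddCircle.measurableEquivIoc (2 * Real.pi) (-Real.pi)).measurable.comp
      (measurable_snd.sub measurable_fst))

theorem measurable_direction : Measurable (Function.uncurry direction) :=
  Measurable.ite (measurable_angle measurableSet_Ici) measurable_const measurable_const

theorem abs_direction (x y : Torus) : |direction x y| = 1 := by
  unfold direction
  split_ifs <;> simp

theorem eventually_angle_add_eq (hy : angle x y ≠ Real.pi) :
    ∀ᶠ t : ℝ in 𝓝 0, angle (x + (t : Torus)) y = angle x y - t := by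
  have hmem : angle x y - 0 ∈ Ioo (-Real.pi) Real.pi := by
    rw [sub_zero]
    exact ⟨(angle_mem_Ioc x y).1, lt_of_le_of_ne (angle_mem_Ioc x y).2 hy⟩
  have hcont : Continuous fun t : ℝ => angle x y - t := by fun_prop
  filter_upwards [hcont.continuousAt.eventually (isOpen_Ioo.mem_nhds hmem)] with t ht
  refine angle_eq_of_sub_eq ?_ (Ioo_subset_Ioc_self ht)
  rw [AddCircle.coe_sub, coe_angle, sub_add_eq_sub_sub]

theorem eventually_direction_add_eq (hx : angle x y ≠ 0) (hy : angle x y ≠ Real.pi) :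
    ∀ᶠ t : ℝ in 𝓝 0, direction (x + (t : Torus)) y = direction x y := by
  have hsub : Tendsto (fun t : ℝ => angle x y - t) (𝓝 0) (𝓝 (angle x y)) := by
    simpa using (tendsto_const_nhds (x := angle x y)).sub (tendsto_id (α := ℝ) (x := 𝓝 0))
  rcases lt_or_gt_of_ne hx with hneg | hpos
  · filter_upwards [eventually_angle_add_eq hy, hsub.eventually_lt_const hneg] with t ht hlt
    rw [direction, direction, ht, if_neg (not_le.2 hlt), if_neg (not_le.2 hneg)]
  · filter_upwards [eventually_angle_add_eq hy, hsub.eventually_const_lt hpos] with t ht hlt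
    rw [direction, direction, ht, if_pos hlt.le, if_pos hpos.le]

theorem hasDerivAt_dist_add (hx : angle x y ≠ 0) (hy : angle x y ≠ Real.pi) :
    HasDerivAt (fun t : ℝ => dist (x + (t : Torus)) y) (-direction x y) 0 := by
  have hsub : HasDerivAt (fun t : ℝ => direction x y * (angle x y - t)) (-direction x y) 0 := by
    simpa using ((hasDerivAt_id (0 : ℝ)).const_sub (angle x y)).const_mul (direction x y)
  refine hsub.congr_of_eventuallyEq ?_
  filter_upwards [eventually_angle_add_eq hy, eventually_direction_add_eq hx hy] with t ht hdir
  rw [← ht, ← hdir, dist_eq_abs_angle, direction]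
  split_ifs with h
  · rw [one_mul, abs_of_nonneg h]
  · rw [neg_one_mul, abs_of_neg (not_le.1 h)]

theorem ae_angle_ne {ν : Measure Torus} [NullSingletonClass ν] (x : Torus) (θ : ℝ) :
    ∀ᵐ y ∂ν, angle x y ≠ θ := by
  filter_upwards [Measure.ae_ne ν (x + (θ : Torus))] with y hy hθ
  exact hy (by rw [← hθ, coe_angle, add_sub_cancel])

end Angle

/-- The signed step `± d(x,y)^(p-1)` from `x` towards `y`: the jumps of the generator are
`x ↦ x + c * pull p x y`, and the potential has derivative `- p ∫ pull p x y ν(dy)`. -/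
noncomputable def pull (p : ℝ) (x y : Torus) : ℝ := dist x y ^ (p - 1) * direction x y

section Pull

variable {p : ℝ}

theorem geodesic_const_mul_rpow (p c : ℝ) (x y : Torus) :
    geodesic x y (c * dist x y ^ (p - 1)) = x + ((c * pull p x y : ℝ) : Torus) := by
  rw [geodesic, pull, mul_assoc]

theorem measurable_pull (p : ℝ) : Measurable (Function.uncurry (pull p)) :=
  ((measurable_fst.dist measurable_snd).pow_const _).mul measurable_direction

theorem abs_pull_le (hp : 1 ≤ p) (x y : Torus) : |pull p x y| ≤ Real.pi ^ (p - 1) := by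
  rw [pull, abs_mul, abs_direction, mul_one, abs_of_nonneg (by positivity)]
  exact Real.rpow_le_rpow dist_nonneg (dist_le_pi x y) (sub_nonneg.2 hp)

theorem pull_add_right_of_mem_Ioo (p : ℝ) (y : Torus) {θ v : ℝ} (hθ : θ ∈ Ioo 0 Real.pi)
    (hv : v = 1 ∨ v = -1) : pull p (y + ((v * θ : ℝ) : Torus)) y = -(v * θ ^ (p - 1)) := by
  have hsub : y - (y + ((v * θ : ℝ) : Torus)) = ((-(v * θ) : ℝ) : Torus) := by
    rw [AddCircle.coe_neg, sub_add_cancel_left]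
  obtain ⟨hpos, hlt⟩ := hθ
  have hangle : angle (y + ((v * θ : ℝ) : Torus)) y = -(v * θ) :=
    angle_eq_of_sub_eq hsub (by rcases hv with rfl | rfl <;> constructor <;> linarith)
  rw [pull, dist_eq_abs_angle, direction, hangle]
  rcases hv with rfl | rfl
  · rw [if_neg (by linarith), one_mul, one_mul, abs_neg, abs_of_pos hpos, mul_neg_one]
  · rw [if_pos (by linarith), neg_one_mul, neg_one_mul, neg_neg, neg_neg, abs_of_pos hpos, mul_one]

end Pull

section BoundedDensity

variable {ν : Measure Torus} {B : ℝ≥0} {F : Torus → ℝ}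

theorem nullSingletonClass_of_le_smul_lam (hν : ν ≤ B • lam) : NullSingletonClass ν := by
  refine ⟨fun x => Measure.absolutelyContinuous_of_le_smul hν ?_⟩
  have hball := AddCircle.volume_closedBall (2 * Real.pi) (x := x) 0
  rw [Metric.closedBall_zero, mul_zero, min_eq_right Real.two_pi_pos.le, ENNReal.ofReal_zero,
    AddCircle.volume_eq_smul_haarAddCircle, Measure.smul_apply, smul_eq_mul, mul_eq_zero] at hball
  exact hball.resolve_left (ENNReal.ofReal_pos.2 Real.two_pi_pos).ne'

theorem measureReal_univ_le (hν : ν ≤ B • lam) : ν.real univ ≤ B := by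
  simpa [Measure.real_def] using ENNReal.toReal_mono (by simp) (hν univ)

theorem integral_le_mul_integral_lam (hν : ν ≤ B • lam) (hF : Integrable F lam)
    (hF0 : ∀ x, 0 ≤ F x) : ∫ x, F x ∂ν ≤ B * ∫ x, F x ∂lam := by
  refine (integral_mono_measure hν (Eventually.of_forall hF0) (hF.smul_measure_nnreal)).trans_eq ?_
  rw [integral_smul_nnreal_measure]
  rfl

end BoundedDensity

section Potential

variable {ν : Measure Torus} {B : ℝ≥0} {p : ℝ}

theorem continuousAt_pull_add {x y : Torus} (hp : 1 ≤ p) (hx : angle x y ≠ 0)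
    (hy : angle x y ≠ Real.pi) : ContinuousAt (fun t : ℝ => pull p (x + (t : Torus)) y) 0 := by
  have := AddCircle.continuous_mk' (2 * Real.pi)
  have hdist : Continuous fun t : ℝ => dist (x + (t : Torus)) y ^ (p - 1) * direction x y :=
    ((by fun_prop : Continuous fun t : ℝ => dist (x + (t : Torus)) y).rpow_const
      fun _ => Or.inr (sub_nonneg.2 hp)).mul_const _
  refine hdist.continuousAt.congr ?_
  filter_upwards [eventually_direction_add_eq hx hy] with t ht
  rw [pull, ht]

theorem continuous_integral_pull [IsFiniteMeasure ν] [NullSingletonClass ν] (hp : 1 ≤ p) :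
    Continuous fun x => ∫ y, pull p x y ∂ν := by
  refine continuous_of_continuousAt_add fun x => ?_
  refine continuousAt_of_dominated (bound := fun _ => Real.pi ^ (p - 1))
    (Eventually.of_forall fun t => ?_) (Eventually.of_forall fun t => ?_) (integrable_const _) ?_
  · exact (measurable_pull p).of_uncurry_left.aestronglyMeasurable
  · exact Eventually.of_forall fun y => abs_pull_le hp _ y
  · filter_upwards [ae_angle_ne x 0, ae_angle_ne x Real.pi] with y hx hy
    exact continuousAt_pull_add hp hx hy

theorem abs_rpow_sub_rpow_le (hp : 1 ≤ p) {a b M : ℝ} (ha : a ∈ Icc 0 M) (hb : b ∈ Icc 0 M) :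
    |a ^ p - b ^ p| ≤ p * M ^ (p - 1) * |a - b| := by
  refine (convex_Icc 0 M).norm_image_sub_le_of_norm_hasDerivWithin_le
    (fun x _ => (Real.hasDerivAt_rpow_const (Or.inr hp)).hasDerivWithinAt) (fun x hx => ?_) hb ha
  have hp0 : 0 ≤ p := by linarith
  rw [Real.norm_of_nonneg (mul_nonneg hp0 (Real.rpow_nonneg hx.1 _))]
  exact mul_le_mul_of_nonneg_left (Real.rpow_le_rpow hx.1 hx.2 (sub_nonneg.2 hp)) hp0

theorem abs_dist_add_rpow_sub_le (hp : 1 ≤ p) (x y : Torus) (s t : ℝ) :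
    |dist (x + (s : Torus)) y ^ p - dist (x + (t : Torus)) y ^ p| ≤
      p * Real.pi ^ (p - 1) * |s - t| := by
  have hdist : |dist (x + (s : Torus)) y - dist (x + (t : Torus)) y| ≤ |s - t| := by
    refine (abs_dist_sub_le _ _ _).trans ?_
    rw [dist_add_left, dist_eq_norm, ← AddCircle.coe_sub]
    exact QuotientAddGroup.norm_mk_le_norm
  have : 0 ≤ p := by linarith
  exact (abs_rpow_sub_rpow_le hp ⟨dist_nonneg, dist_le_pi _ _⟩ ⟨dist_nonneg, dist_le_pi _ _⟩).trans
    (mul_le_mul_of_nonneg_left hdist (by positivity))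

/-- The derivative of `potential ν p` when `ν` has no atoms. -/
noncomputable def potentialDeriv (ν : Measure Torus) (p : ℝ) (x : Torus) : ℝ :=
  -p * ∫ y, pull p x y ∂ν

theorem hasCircleDeriv_potential [IsFiniteMeasure ν] [NullSingletonClass ν] (hp : 1 ≤ p) :
    HasCircleDeriv (potential ν p) (potentialDeriv ν p) := by
  intro x
  rw [potentialDeriv, ← integral_const_mul]
  have : 0 ≤ p := by linarith
  have hcont : ∀ x : Torus, Continuous fun y => dist x y ^ p := fun x =>
    (continuous_const.dist continuous_id).rpow_const fun _ => Or.inr (by positivity)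
  refine (hasDerivAt_integral_of_dominated_loc_of_lip (𝕜 := ℝ)
    (F := fun t y => dist (x + (t : Torus)) y ^ p)
    (bound := fun _ => p * Real.pi ^ (p - 1)) univ_mem
    (Eventually.of_forall fun t => (hcont _).aestronglyMeasurable)
    (integrable_of_continuous (hcont _))
    ((measurable_pull p).of_uncurry_left.const_mul _).aestronglyMeasurable
    (Eventually.of_forall fun y => ?_) (integrable_const _) ?_).2
  · refine LipschitzOnWith.of_dist_le_mul fun s _ t _ => ?_
    rw [Real.coe_nnabs, abs_of_nonneg (by positivity)]
    exact abs_dist_add_rpow_sub_le hp x y s t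
  · filter_upwards [ae_angle_ne x 0, ae_angle_ne x Real.pi] with y hx hy
    refine ((hasDerivAt_dist_add hx hy).rpow_const (Or.inr hp)).congr_deriv ?_
    simp only [AddCircle.coe_zero, add_zero, pull]
    ring

/-- The unnormalized Gibbs density `exp (-β U_p)`. -/
noncomputable def gibbsWeight (ν : Measure Torus) (p β : ℝ) (x : Torus) : ℝ :=
  Real.exp (-β * potential ν p x)

theorem isWeight_gibbsWeight (hν : ν ≤ B • lam) (hp : 1 ≤ p) {β : ℝ} (hβ : 0 ≤ β) :
    IsWeight (gibbsWeight ν p β)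
      (fun x => -β * potentialDeriv ν p x * gibbsWeight ν p β x)
      (β * (p * Real.pi ^ (p - 1) * B)) := by
  have := isFiniteMeasure_of_le _ hν
  have := nullSingletonClass_of_le_smul_lam hν
  have hU := hasCircleDeriv_potential (ν := ν) hp
  have hpull := continuous_integral_pull (ν := ν) hp
  have hw := hU.exp_const_mul (-β)
  have hwc := hw.continuous
  refine ⟨hw, ?_, fun x => Real.exp_pos _, fun x => ?_⟩
  · unfold gibbsWeight potentialDeriv
    fun_prop
  · have hbound : |∫ y, pull p x y ∂ν| ≤ Real.pi ^ (p - 1) * B :=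
      (norm_integral_le_of_norm_le_const (f := pull p x) (.of_forall (abs_pull_le hp x))).trans
        (mul_le_mul_of_nonneg_left (measureReal_univ_le hν) (by positivity))
    have hp0 : 0 ≤ p := by linarith
    rw [abs_mul, gibbsWeight, Real.abs_exp, abs_mul, potentialDeriv, abs_mul, abs_neg, abs_neg,
      abs_of_nonneg hβ, abs_of_nonneg hp0, mul_assoc p]
    gcongr

end Potential

theorem integral_lam_eq_add_sides {F : Torus → ℝ} (hF : Integrable F lam) (y : Torus) :
    ∫ x, F x ∂lam = (2 * Real.pi)⁻¹ * ((∫ θ in 0..Real.pi, F (y + ((1 * θ : ℝ) : Torus)))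
      + ∫ θ in 0..Real.pi, F (y + ((-1 * θ : ℝ) : Torus))) := by
  have hend : -Real.pi + 2 * Real.pi = Real.pi := by ring
  have hvol : Integrable (fun x => F (y + x)) (volume : Measure Torus) := by
    rw [AddCircle.volume_eq_smul_haarAddCircle]
    exact (hF.comp_add_left y).smul_measure ENNReal.ofReal_ne_top
  have hline : IntervalIntegrable (fun θ : ℝ => F (y + (θ : Torus))) volume
      (-Real.pi) Real.pi := by
    rw [intervalIntegrable_iff_integrableOn_Ioc_of_le (by linarith [Real.pi_pos])]
    have := (AddCircle.measurePreserving_mk (2 * Real.pi) (-Real.pi)).integrable_comp_of_integrable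
      hvol
    rwa [hend] at this
  have hmem : (0 : ℝ) ∈ uIcc (-Real.pi) Real.pi := by
    rw [uIcc_of_le] <;> [constructor; skip] <;> linarith [Real.pi_pos]
  rw [← integral_add_left_eq_self F y, integral_lam _ (-Real.pi), hend,
    ← intervalIntegral.integral_add_adjacent_intervals (b := 0)
      (hline.mono_set (uIcc_subset_uIcc_left hmem)) (hline.mono_set (uIcc_subset_uIcc_right hmem)),
    add_comm]
  simp only [one_mul, neg_one_mul]
  rw [intervalIntegral.integral_comp_neg (fun θ : ℝ => F (y + (θ : Torus))), neg_zero]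

theorem isStepProfile_const_mul_rpow {p c b : ℝ} (hp : 1 ≤ p) (hc : 0 ≤ c) (hb : 0 ≤ b) :
    IsStepProfile (fun θ => c * θ ^ (p - 1)) (fun θ => c * ((p - 1) * θ ^ (p - 1 - 1))) b
      (c * b ^ (p - 1)) where
  nonneg_length := hb
  continuous := (Real.continuous_rpow_const (sub_nonneg.2 hp)).const_mul c
  mem_Icc _ hθ := ⟨mul_nonneg hc (Real.rpow_nonneg hθ.1 _),
    mul_le_mul_of_nonneg_left (Real.rpow_le_rpow hθ.1 hθ.2 (sub_nonneg.2 hp)) hc⟩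
  hasDerivAt _ hθ := (Real.hasDerivAt_rpow_const (Or.inl hθ.1.ne')).const_mul c
  deriv_nonneg _ hθ := mul_nonneg hc (mul_nonneg (sub_nonneg.2 hp) (Real.rpow_nonneg hθ.1.le _))

/-- The first-order Taylor remainder of a function `g` with derivative `h` along the jump
`c * pull p x y`. -/
noncomputable def taylorRemainder (p c : ℝ) (g h : Torus → ℝ) (x y : Torus) : ℝ :=
  g (x + ((c * pull p x y : ℝ) : Torus)) - g x - c * pull p x y * h x

/-- The density in `u ∈ [0, 1]` of `taylorRemainder p c g h x y * (g x * m x)`, where `u` is the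
fraction of the jump that has been completed. -/
noncomputable def jumpRemainder (p c : ℝ) (g h m : Torus → ℝ) (u : ℝ) (x y : Torus) : ℝ :=
  c * pull p x y * (h (x + ((u * (c * pull p x y) : ℝ) : Torus)) - h x) * (g x * m x)

section JumpRemainder

variable {p c : ℝ} {g h m : Torus → ℝ} {ν : Measure Torus}

theorem measurable_jumpRemainder (p c : ℝ) (hg : Continuous g) (hh : Continuous h)
    (hm : Continuous m) :
    Measurable fun z : ℝ × Torus × Torus => jumpRemainder p c g h m z.1 z.2.1 z.2.2 := by
  have := AddCircle.measurable_mk' (a := 2 * Real.pi)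
  have hpull : Measurable fun z : ℝ × Torus × Torus => pull p z.2.1 z.2.2 :=
    (measurable_pull p).comp measurable_snd
  have hgm := hg.measurable
  have hhm := hh.measurable
  have hmm := hm.measurable
  unfold jumpRemainder
  fun_prop

theorem exists_abs_jumpRemainder_le (hp : 1 ≤ p) (c : ℝ) (hg : Continuous g) (hh : Continuous h)
    (hm : Continuous m) :
    ∃ M, ∀ u ∈ Icc (0 : ℝ) 1, ∀ x y, |jumpRemainder p c g h m u x y| ≤ M := by
  have := AddCircle.continuous_mk' (2 * Real.pi)
  have hcont : Continuous fun z : ℝ × ℝ × Torus =>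
      z.2.1 * (h (z.2.2 + ((z.1 * z.2.1 : ℝ) : Torus)) - h z.2.2) * (g z.2.2 * m z.2.2) := by
    fun_prop
  have hcompact : IsCompact (Icc (0 : ℝ) 1 ×ˢ
      Icc (-(|c| * Real.pi ^ (p - 1))) (|c| * Real.pi ^ (p - 1)) ×ˢ (univ : Set Torus)) :=
    isCompact_Icc.prod (isCompact_Icc.prod isCompact_univ)
  obtain ⟨M, hM⟩ := hcompact.exists_bound_of_continuousOn hcont.continuousOn
  refine ⟨M, fun u hu x y => hM (u, c * pull p x y, x) ⟨hu, abs_le.1 ?_, mem_univ _⟩⟩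
  rw [abs_mul]
  exact mul_le_mul_of_nonneg_left (abs_pull_le hp x y) (abs_nonneg c)

theorem intervalIntegral_jumpRemainder (hg : HasCircleDeriv g h) (hh : Continuous h) (p c : ℝ)
    (m : Torus → ℝ) (x y : Torus) :
    ∫ u in (0 : ℝ)..1, jumpRemainder p c g h m u x y =
      taylorRemainder p c g h x y * (g x * m x) := by
  have hcont : Continuous fun u : ℝ =>
      c * pull p x y * h (x + ((u * (c * pull p x y) : ℝ) : Torus)) := by
    have := AddCircle.continuous_mk' (2 * Real.pi)
    fun_prop
  simp only [jumpRemainder, taylorRemainder, intervalIntegral.integral_mul_const, mul_sub]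
  rw [intervalIntegral.integral_sub (hcont.intervalIntegrable _ _) intervalIntegrable_const,
    ← hg.sub_eq_intervalIntegral hh, intervalIntegral.integral_const, sub_zero, one_smul]

theorem integral_jumpRemainder_eq_transport (hp : 1 ≤ p) (c : ℝ) (hg : Continuous g)
    (hh : Continuous h) (hm : Continuous m) {u : ℝ} (hu : u ∈ Icc (0 : ℝ) 1) (y : Torus) :
    ∫ x, jumpRemainder p c g h m u x y ∂lam =
      (2 * Real.pi)⁻¹ * (transport g h m (fun θ => c * θ ^ (p - 1)) Real.pi 1 u y
        + transport g h m (fun θ => c * θ ^ (p - 1)) Real.pi (-1) u y) := by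
  obtain ⟨M, hM⟩ := exists_abs_jumpRemainder_le hp c hg hh hm
  have hmeas : Measurable fun x => jumpRemainder p c g h m u x y :=
    (measurable_jumpRemainder p c hg hh hm).comp (g := fun z : ℝ × Torus × Torus =>
      jumpRemainder p c g h m z.1 z.2.1 z.2.2) (f := fun x => (u, x, y)) (by fun_prop)
  have hint : Integrable (fun x => jumpRemainder p c g h m u x y) lam :=
    .of_bound hmeas.aestronglyMeasurable M (.of_forall fun x => hM u hu x y)
  have hside : ∀ v : ℝ, v = 1 ∨ v = -1 →
      ∫ θ in 0..Real.pi, jumpRemainder p c g h m u (y + ((v * θ : ℝ) : Torus)) y =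
        transport g h m (fun θ => c * θ ^ (p - 1)) Real.pi v u y := fun v hv => by
    refine intervalIntegral.integral_congr_ae ?_
    filter_upwards [Measure.ae_ne volume Real.pi] with θ hne hθ
    rw [uIoc_of_le Real.pi_pos.le] at hθ
    have hstep : c * pull p (y + ((v * θ : ℝ) : Torus)) y = -(v * (c * θ ^ (p - 1))) := by
      rw [pull_add_right_of_mem_Ioo p y ⟨hθ.1, lt_of_le_of_ne hθ.2 hne⟩ hv]
      ring
    rw [jumpRemainder, hstep]
  rw [integral_lam_eq_add_sides hint y, hside 1 (Or.inl rfl), hside (-1) (Or.inr rfl)]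

theorem integrable_intervalIntegral_jumpRemainder [IsFiniteMeasure ν] (hp : 1 ≤ p) (c : ℝ)
    (hg : Continuous g) (hh : Continuous h) (hm : Continuous m) :
    Integrable (Function.uncurry fun u (z : Torus × Torus) => jumpRemainder p c g h m u z.1 z.2)
      ((volume.restrict (uIoc 0 1)).prod (lam.prod ν)) := by
  obtain ⟨M, hM⟩ := exists_abs_jumpRemainder_le hp c hg hh hm
  rw [uIoc_of_le zero_le_one]
  have hmem : ∀ᵐ z : ℝ × Torus × Torus ∂(volume.restrict (Ioc 0 1)).prod (lam.prod ν),
      z.1 ∈ Ioc (0 : ℝ) 1 :=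
    Measure.quasiMeasurePreserving_fst.ae (ae_restrict_mem measurableSet_Ioc)
  refine .of_bound (measurable_jumpRemainder p c hg hh hm).aestronglyMeasurable M ?_
  exact hmem.mono fun z hz => hM z.1 (Ioc_subset_Icc_self hz) z.2.1 z.2.2

end JumpRemainder

section Remainder

variable {p c K : ℝ} {g h m m' : Torus → ℝ} {ν : Measure Torus} {B : ℝ≥0}

theorem abs_integral_jumpRemainder_le (hν : ν ≤ B • lam) (hp : 1 ≤ p) (hc : 0 ≤ c)
    (hw : IsWeight m m' K) (hg : HasCircleDeriv g h) (hh : Continuous h) {u : ℝ}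
    (hu : u ∈ Icc (0 : ℝ) 1) :
    |∫ y, ∫ x, jumpRemainder p c g h m u x y ∂lam ∂ν| ≤
      B / Real.pi * ((c * Real.pi ^ (p - 1)) ^ 2 * ((4 + Real.pi * (2 + K)) *
        (Real.exp (K * (c * Real.pi ^ (p - 1))) / 2 * energy g h m))) := by
  have := isFiniteMeasure_of_le _ hν
  have hτ := isStepProfile_const_mul_rpow hp hc Real.pi_pos.le
  set τ : ℝ → ℝ := fun θ => c * θ ^ (p - 1)
  set κ := (c * Real.pi ^ (p - 1)) ^ 2 * ((4 + Real.pi * (2 + K)) *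
        (Real.exp (K * (c * Real.pi ^ (p - 1))) / 2 * energy g h m))
  have hside : ∀ v : ℝ, |v| = 1 → ∫ y, |transport g h m τ Real.pi v u y| ∂ν ≤ B * κ :=
    fun v hv =>
      (integral_le_mul_integral_lam hν (integrable_of_continuous (continuous_transport
        hg.continuous hh hw.continuous hτ.continuous _ _ _).abs) fun _ => abs_nonneg _).trans
        (mul_le_mul_of_nonneg_left (hw.integral_abs_transport_le hg hh hτ hv hu) B.2)
  have hint : ∀ v : ℝ, Integrable (transport g h m τ Real.pi v u) ν := fun v =>
    integrable_of_continuous (continuous_transport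
      hg.continuous hh hw.continuous hτ.continuous _ _ _)
  simp only [integral_jumpRemainder_eq_transport hp c hg.continuous hh hw.continuous hu]
  rw [integral_const_mul, integral_add (hint 1) (hint (-1)), abs_mul,
    abs_of_pos (inv_pos.2 Real.two_pi_pos)]
  calc (2 * Real.pi)⁻¹ * |∫ y, transport g h m τ Real.pi 1 u y ∂ν
        + ∫ y, transport g h m τ Real.pi (-1) u y ∂ν|
      ≤ (2 * Real.pi)⁻¹ * (B * κ + B * κ) := by
        refine mul_le_mul_of_nonneg_left ?_ (inv_pos.2 Real.two_pi_pos).le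
        exact (abs_add_le _ _).trans (add_le_add
          (abs_integral_le_integral_abs.trans (hside 1 abs_one))
          (abs_integral_le_integral_abs.trans (hside (-1) (by rw [abs_neg, abs_one]))))
    _ = B / Real.pi * κ := by
        have := Real.pi_ne_zero
        field_simp
        ring

theorem integrable_taylorRemainder [IsFiniteMeasure ν] (hp : 1 ≤ p) (c : ℝ)
    (hg : HasCircleDeriv g h) (hh : Continuous h) (hm : Continuous m) :
    Integrable (fun z : Torus × Torus => taylorRemainder p c g h z.1 z.2 * (g z.1 * m z.1))
      (lam.prod ν) := by
  have hint := (integrable_intervalIntegral_jumpRemainder (ν := ν) hp c hg.continuous hh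
    hm).integral_prod_right
  rw [uIoc_of_le zero_le_one] at hint
  simpa only [Function.uncurry_apply_pair, ← intervalIntegral.integral_of_le zero_le_one,
    intervalIntegral_jumpRemainder hg hh] using hint

theorem abs_integral_taylorRemainder_le (hν : ν ≤ B • lam) (hp : 1 ≤ p) (hc : 0 ≤ c)
    (hw : IsWeight m m' K) (hg : HasCircleDeriv g h) (hh : Continuous h) :
    |∫ x, ∫ y, taylorRemainder p c g h x y * (g x * m x) ∂ν ∂lam| ≤
      B / Real.pi * ((c * Real.pi ^ (p - 1)) ^ 2 * ((4 + Real.pi * (2 + K)) *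
        (Real.exp (K * (c * Real.pi ^ (p - 1))) / 2 * energy g h m))) := by
  have := isFiniteMeasure_of_le _ hν
  have hint := integrable_intervalIntegral_jumpRemainder (ν := ν) hp c hg.continuous hh
    hw.continuous
  rw [← integral_prod _ (integrable_taylorRemainder hp c hg hh hw.continuous)]
  simp only [← intervalIntegral_jumpRemainder hg hh]
  rw [← intervalIntegral_integral_swap hint, ← Real.norm_eq_abs]
  refine (intervalIntegral.norm_integral_le_of_norm_le_const_ae (E := ℝ) ?_).trans_eq
    (by rw [sub_zero, abs_one, mul_one])
  filter_upwards [(ae_restrict_iff' measurableSet_uIoc).1 hint.prod_right_ae] with u hint_u hu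
  rw [uIoc_of_le zero_le_one] at hint_u hu
  rw [Real.norm_eq_abs,
    integral_prod_symm (fun z => jumpRemainder p c g h m u z.1 z.2) (hint_u hu)]
  exact abs_integral_jumpRemainder_le hν hp hc hw hg hh (Ioc_subset_Icc_self hu)

end Remainder

section Generator

variable {p α β : ℝ} {f : Torus → ℝ} {ν : Measure Torus} {B : ℝ≥0}

theorem integral_gibbs (ν : Measure Torus) (p β : ℝ) (F : Torus → ℝ) :
    ∫ x, F x ∂gibbs ν p β =
      (∫ x, gibbsWeight ν p β x ∂lam)⁻¹ * ∫ x, F x * gibbsWeight ν p β x ∂lam := by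
  rw [gibbs, integral_tilted, ← integral_const_mul]
  simp only [gibbsWeight, smul_eq_mul]
  congr with x
  ring

theorem integrable_gibbs_iff (hw : Integrable (gibbsWeight ν p β) lam) (F : Torus → ℝ) :
    Integrable F (gibbs ν p β) ↔ Integrable (fun x => F x * gibbsWeight ν p β x) lam := by
  rw [gibbs, integrable_tilted_iff hw]
  simp only [gibbsWeight, smul_eq_mul, mul_comm]

/-- The drift `- β U' / 2` contained in the jumps turns `f'' / 2` into the operator
`e^(β U) (e^(-β U) f')' / 2`, which is symmetric for the Gibbs measure. -/
theorem generator_mul_self_mul_gibbsWeight [IsFiniteMeasure ν] (hp : 1 ≤ p) (hα : α ≠ 0)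
    (hf : IsC2 f) (x : Torus) :
    generator ν p α β f x * f x * gibbsWeight ν p β x =
      1 / 2 * ((circleDeriv (circleDeriv f) x * f x + circleDeriv f x * circleDeriv f x)
          * gibbsWeight ν p β x + circleDeriv f x * f x *
            (-β * potentialDeriv ν p x * gibbsWeight ν p β x))
        - 1 / 2 * (circleDeriv f x ^ 2 * gibbsWeight ν p β x)
        + 1 / α * ∫ y, taylorRemainder p (p / 2 * β * α) f (circleDeriv f) x y *
            (f x * gibbsWeight ν p β x) ∂ν := by
  have := AddCircle.measurable_mk' (a := 2 * Real.pi)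
  have hpullm := (measurable_pull p).of_uncurry_left (x := x)
  have hpull : Integrable (pull p x) ν :=
    .of_bound hpullm.aestronglyMeasurable _ (.of_forall (abs_pull_le hp x))
  have hjump : Integrable (fun y => f (x + ((p / 2 * β * α * pull p x y : ℝ) : Torus))) ν := by
    obtain ⟨M, hM⟩ :=
      isCompact_univ.exists_bound_of_continuousOn hf.hasCircleDeriv.continuous.continuousOn
    have hfm := hf.hasCircleDeriv.continuous.measurable
    exact .of_bound (hfm.comp (by fun_prop)).aestronglyMeasurable M
      (.of_forall fun y => hM _ (mem_univ _))
  have hdiff : Integrable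
      (fun y => f (x + ((p / 2 * β * α * pull p x y : ℝ) : Torus)) - f x) ν :=
    hjump.sub (integrable_const _)
  simp only [generator, geodesic_const_mul_rpow, taylorRemainder, potentialDeriv]
  rw [integral_mul_const, integral_sub hdiff ((hpull.const_mul _).mul_const _),
    integral_mul_const, integral_const_mul]
  field_simp
  ring

theorem integral_generator_mul_self_mul_gibbsWeight (hν : ν ≤ B • lam) (hp : 1 ≤ p) (hα : α ≠ 0)
    (hβ : 0 ≤ β) (hf : IsC2 f) :
    Integrable (fun x => generator ν p α β f x * f x * gibbsWeight ν p β x) lam ∧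
    ∫ x, generator ν p α β f x * f x * gibbsWeight ν p β x ∂lam =
      -(1 / 2) * ∫ x, circleDeriv f x ^ 2 * gibbsWeight ν p β x ∂lam
        + 1 / α * ∫ x, ∫ y, taylorRemainder p (p / 2 * β * α) f (circleDeriv f) x y
              * (f x * gibbsWeight ν p β x) ∂ν ∂lam := by
  have := isFiniteMeasure_of_le _ hν
  have hw := isWeight_gibbsWeight hν hp hβ
  have hwc := hw.continuous
  have hw' := hw.continuous_deriv
  have hfc := hf.hasCircleDeriv.continuous
  have hdc := hf.hasCircleDeriv_circleDeriv.continuous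
  have hddc := hf.continuous_circleDeriv_circleDeriv
  have hflux := (hf.hasCircleDeriv_circleDeriv.mul hf.hasCircleDeriv).mul hw.hasCircleDeriv
  have hfluxc : Continuous fun x =>
      (circleDeriv (circleDeriv f) x * f x + circleDeriv f x * circleDeriv f x)
        * gibbsWeight ν p β x + circleDeriv f x * f x *
          (-β * potentialDeriv ν p x * gibbsWeight ν p β x) := by fun_prop
  have hrem : Integrable (fun x => ∫ y, taylorRemainder p (p / 2 * β * α) f (circleDeriv f) x y *
      (f x * gibbsWeight ν p β x) ∂ν) lam :=
    (integrable_taylorRemainder hp _ hf.hasCircleDeriv hdc hwc).integral_prod_left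
  have hfluxint := (integrable_of_continuous (μ := lam) hfluxc).const_mul (1 / 2)
  have hdint : Integrable (fun x => 1 / 2 * (circleDeriv f x ^ 2 * gibbsWeight ν p β x)) lam :=
    integrable_of_continuous (by fun_prop)
  have hsub : Integrable (fun x => 1 / 2 * ((circleDeriv (circleDeriv f) x * f x
      + circleDeriv f x * circleDeriv f x) * gibbsWeight ν p β x + circleDeriv f x * f x *
        (-β * potentialDeriv ν p x * gibbsWeight ν p β x))
      - 1 / 2 * (circleDeriv f x ^ 2 * gibbsWeight ν p β x)) lam := hfluxint.sub hdint
  simp only [generator_mul_self_mul_gibbsWeight hp hα hf]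
  refine ⟨hsub.add (hrem.const_mul (1 / α)), ?_⟩
  rw [integral_add hsub (hrem.const_mul (1 / α)), integral_sub hfluxint hdint,
    integral_const_mul, integral_const_mul, integral_const_mul, hflux.integral_eq_zero hfluxc]
  ring

end Generator

section Estimate

variable {p α β σ : ℝ}

theorem inv_mul_sq_mul_exp_le {D b : ℝ} (hD : 0 ≤ D) (hb : 0 ≤ b) (hα : 0 < α) (hβ : 1 ≤ β)
    (hαβ : α * β ^ 2 ≤ σ) :
    1 / α * (b / Real.pi * ((D * β * α / 2) ^ 2 * ((4 + Real.pi * (2 + β * (D * b))) *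
        (Real.exp (β * (D * b) * (D * β * α / 2)) / 2)))) ≤
      b * D ^ 2 / (8 * Real.pi) * (4 + Real.pi * (2 + D * b)) * Real.exp (D ^ 2 * b / 2 * σ)
        * α * β ^ 3 := by
  have hπ := Real.pi_pos
  have : 0 ≤ β := by linarith
  have hexp : Real.exp (β * (D * b) * (D * β * α / 2)) ≤ Real.exp (D ^ 2 * b / 2 * σ) := by
    refine Real.exp_le_exp.2 ?_
    calc β * (D * b) * (D * β * α / 2) = D ^ 2 * b / 2 * (α * β ^ 2) := by ring
      _ ≤ D ^ 2 * b / 2 * σ := by gcongr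
  have hlin : 4 + Real.pi * (2 + β * (D * b)) ≤ β * (4 + Real.pi * (2 + D * b)) := by
    nlinarith
  calc 1 / α * (b / Real.pi * ((D * β * α / 2) ^ 2 * ((4 + Real.pi * (2 + β * (D * b))) *
        (Real.exp (β * (D * b) * (D * β * α / 2)) / 2))))
      = b * D ^ 2 / (8 * Real.pi) * α * β ^ 2 * ((4 + Real.pi * (2 + β * (D * b))) *
          Real.exp (β * (D * b) * (D * β * α / 2))) := by
        field_simp
        ring
    _ ≤ b * D ^ 2 / (8 * Real.pi) * α * β ^ 2 * (β * (4 + Real.pi * (2 + D * b)) *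
          Real.exp (D ^ 2 * b / 2 * σ)) := by gcongr
    _ = b * D ^ 2 / (8 * Real.pi) * (4 + Real.pi * (2 + D * b)) * Real.exp (D ^ 2 * b / 2 * σ)
        * α * β ^ 3 := by ring

theorem exists_integral_generator_mul_self_mul_gibbsWeight_le (hp : 1 ≤ p) (B : ℝ≥0) (σ : ℝ) :
    ∃ C, 0 < C ∧ ∀ ν : Measure Torus, ν ≤ B • lam → ∀ α β : ℝ, 0 < α → 1 ≤ β → α * β ^ 2 ≤ σ →
      ∀ f : Torus → ℝ, IsC2 f →
        ∫ x, generator ν p α β f x * f x * gibbsWeight ν p β x ∂lam ≤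
          -(1 / 2) * ∫ x, circleDeriv f x ^ 2 * gibbsWeight ν p β x ∂lam
            + C * α * β ^ 3 * energy f (circleDeriv f) (gibbsWeight ν p β) := by
  have : 0 ≤ p := by linarith
  have hD : 0 ≤ p * Real.pi ^ (p - 1) := by positivity
  set D := p * Real.pi ^ (p - 1)
  set C₀ := B * D ^ 2 / (8 * Real.pi) * (4 + Real.pi * (2 + D * B)) *
    Real.exp (D ^ 2 * B / 2 * σ)
  refine ⟨C₀ + 1, by positivity, fun ν hν α β hα hβ hαβ f hf => ?_⟩
  have hβ0 : 0 ≤ β := by linarith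
  have hw : IsWeight (gibbsWeight ν p β) _ (β * (D * B)) := isWeight_gibbsWeight hν hp hβ0
  have henergy := energy_nonneg f (circleDeriv f) fun x => (hw.pos x).le
  have hrem := abs_integral_taylorRemainder_le hν hp (c := p / 2 * β * α) (by positivity) hw
    hf.hasCircleDeriv hf.hasCircleDeriv_circleDeriv.continuous
  rw [show p / 2 * β * α * Real.pi ^ (p - 1) = D * β * α / 2 by ring] at hrem
  have hle := mul_le_mul_of_nonneg_left ((le_abs_self _).trans hrem) (one_div_pos.2 hα).le
  have hconst := mul_le_mul_of_nonneg_right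
    (inv_mul_sq_mul_exp_le hD B.coe_nonneg hα hβ hαβ) henergy
  have hC₀ : C₀ * α * β ^ 3 ≤ (C₀ + 1) * α * β ^ 3 := by
    gcongr
    linarith
  rw [(integral_generator_mul_self_mul_gibbsWeight hν hp hα.ne' hβ0 hf).2]
  refine add_le_add_right (hle.trans (le_trans (le_of_eq ?_) (hconst.trans
    (mul_le_mul_of_nonneg_right hC₀ henergy)))) _
  ring

end Estimate

section Hoelder

variable {ν : Measure Torus} {ρ : Torus → ℝ} {A a : ℝ}

theorem continuous_of_abs_sub_le_dist_rpow (ha : 0 < a)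
    (hρ : ∀ x y, |ρ y - ρ x| ≤ A * dist x y ^ a) : Continuous ρ := by
  refine continuous_iff_continuousAt.2 fun x => tendsto_iff_dist_tendsto_zero.2 ?_
  have hlim : Tendsto (fun y => A * dist x y ^ a) (𝓝 x) (𝓝 0) := by
    have hcont : Continuous fun y => A * dist x y ^ a :=
      ((continuous_const.dist continuous_id).rpow_const fun _ => Or.inr ha.le).const_mul A
    simpa only [dist_self, Real.zero_rpow ha.ne', mul_zero] using hcont.tendsto x
  exact squeeze_zero (fun _ => dist_nonneg) (fun y => hρ x y) hlim

theorem le_integral_lam_add_of_abs_sub_le_dist_rpow (hA : 0 ≤ A) (ha : 0 < a) (ha1 : a ≤ 1)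
    (hρ : ∀ x y, |ρ y - ρ x| ≤ A * dist x y ^ a) (x : Torus) :
    ρ x ≤ ∫ y, ρ y ∂lam + A * Real.pi := by
  have hpoint : ∀ y, ρ x - A * Real.pi ≤ ρ y := fun y => by
    have hdist : dist y x ^ a ≤ Real.pi :=
      calc dist y x ^ a ≤ Real.pi ^ a :=
            Real.rpow_le_rpow dist_nonneg (dist_le_pi y x) ha.le
        _ ≤ Real.pi ^ (1 : ℝ) :=
            Real.rpow_le_rpow_of_exponent_le (by linarith [Real.pi_gt_three]) ha1
        _ = Real.pi := Real.rpow_one _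
    have := (le_abs_self _).trans ((hρ y x).trans (mul_le_mul_of_nonneg_left hdist hA))
    linarith
  have hmono := integral_mono (μ := lam) (integrable_const _)
    (integrable_of_continuous (continuous_of_abs_sub_le_dist_rpow ha hρ)) hpoint
  simp only [integral_const, probReal_univ, one_smul] at hmono
  linarith

theorem le_smul_lam_of_abs_sub_le_dist_rpow [IsProbabilityMeasure ν] (hA : 0 ≤ A) (ha : 0 < a)
    (ha1 : a ≤ 1) (hρ0 : ∀ x, 0 ≤ ρ x) (hν : ν = lam.withDensity fun x => ENNReal.ofReal (ρ x))
    (hρ : ∀ x y, |ρ y - ρ x| ≤ A * dist x y ^ a) : ν ≤ (1 + A * Real.pi).toNNReal • lam := by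
  have hρc := continuous_of_abs_sub_le_dist_rpow ha hρ
  have hmass : ∫ y, ρ y ∂lam = 1 := by
    rw [integral_eq_lintegral_of_nonneg_ae (.of_forall hρ0) hρc.aestronglyMeasurable,
      ← setLIntegral_univ, ← withDensity_apply _ MeasurableSet.univ, ← hν, measure_univ,
      ENNReal.toReal_one]
  rw [hν]
  refine (withDensity_mono (g := fun _ => ((1 + A * Real.pi).toNNReal : ENNReal))
    (.of_forall fun x => ENNReal.ofReal_le_ofReal ?_)).trans_eq (withDensity_const _)
  exact (le_integral_lam_add_of_abs_sub_le_dist_rpow hA ha ha1 hρ x).trans_eq (by rw [hmass])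

end Hoelder

theorem aTilde_le_one (p : ℝ) : aTilde p ≤ 1 := by
  unfold aTilde
  split_ifs with h
  · exact le_rfl
  · push Not at h
    linarith [h.2]

theorem le_rpow_aTilde {α : ℝ} (p : ℝ) (hα : 0 < α) (hα1 : α ≤ 1) : α ≤ α ^ aTilde p := by
  simpa only [Real.rpow_one] using Real.rpow_le_rpow_of_exponent_ge hα hα1 (aTilde_le_one p)

end CircleMeans

theorem mainTheorem6_general {p : ℝ} (hp : 1 ≤ p) (B : ℝ≥0) (σ : ℝ) :
    ∃ C, 0 < C ∧ ∀ ν : Measure Torus, ν ≤ B • lam → ∀ α β : ℝ, 0 < α → 1 ≤ β → α * β ^ 2 ≤ σ →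
      ∀ f : Torus → ℝ, IsC2 f →
        Integrable (fun x => generator ν p α β f x * f x) (gibbs ν p β) ∧
        ∫ x, generator ν p α β f x * f x ∂gibbs ν p β ≤
          -(1 / 2 - C * α * β ^ 3) * ∫ x, circleDeriv f x ^ 2 ∂gibbs ν p β
            + C * α * β ^ 3 * ∫ x, f x ^ 2 ∂gibbs ν p β := by
  obtain ⟨C, hC, hmain⟩ := exists_integral_generator_mul_self_mul_gibbsWeight_le hp B σ
  refine ⟨C, hC, fun ν hν α β hα hβ hαβ f hf => ?_⟩
  have hβ0 : 0 ≤ β := by linarith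
  have hw := isWeight_gibbsWeight hν hp hβ0
  refine ⟨(integrable_gibbs_iff (integrable_of_continuous hw.continuous) _).2
    (integral_generator_mul_self_mul_gibbsWeight hν hp hα.ne' hβ0 hf).1, ?_⟩
  have hnorm : 0 ≤ (∫ x, gibbsWeight ν p β x ∂lam)⁻¹ :=
    inv_nonneg.2 (integral_nonneg fun x => (hw.pos x).le)
  rw [integral_gibbs, integral_gibbs, integral_gibbs]
  refine (mul_le_mul_of_nonneg_left (hmain ν hν α β hα hβ hαβ f hf) hnorm).trans_eq ?_
  rw [energy]
  ring

theorem mainTheorem6 (p : ℝ) (hp : 1 ≤ p) :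
    ∃ σ : ℝ, 0 < σ ∧ σ < 1 / 2 ∧
      ∀ A : ℝ, 0 < A → ∃ c₃ : ℝ, 0 < c₃ ∧
        ∀ (a : ℝ), 0 < a → a ≤ 1 →
        ∀ (ν : Measure Torus) [IsProbabilityMeasure ν] (ρ : Torus → ℝ),
          (∀ x, 0 ≤ ρ x) →
          ν = lam.withDensity (fun x => ENNReal.ofReal (ρ x)) →
          (∀ x y, |ρ y - ρ x| ≤ A * dist x y ^ a) →
          ∀ α β : ℝ, 0 < α → 1 ≤ β → α * β ^ 2 ≤ σ →
            ∀ f : Torus → ℝ, IsC2 f →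
              Integrable (fun x => generator ν p α β (fun z => f z - 1) x * (f x - 1))
                (gibbs ν p β) ∧
              ∫ x, generator ν p α β (fun z => f z - 1) x * (f x - 1) ∂(gibbs ν p β)
                ≤ -(1 / 2 - c₃ * α ^ aTilde p * β ^ 3)
                      * ∫ x, (circleDeriv f x) ^ 2 ∂(gibbs ν p β)
                  + c₃ * α ^ aTilde p * β ^ 3 * ∫ x, (f x - 1) ^ 2 ∂(gibbs ν p β) := by
  refine ⟨1 / 4, by norm_num, by norm_num, fun A hA => ?_⟩
  obtain ⟨C, hC, hmain⟩ := mainTheorem6_general hp (1 + A * Real.pi).toNNReal (1 / 4)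
  refine ⟨C, hC, fun a ha ha1 ν _ ρ hρ0 hν hρ α β hα hβ hαβ f hf => ?_⟩
  obtain ⟨hint, hle⟩ := hmain ν (le_smul_lam_of_abs_sub_le_dist_rpow hA.le ha ha1 hρ0 hν hρ) α β
    hα hβ hαβ _ (hf.sub_const 1)
  rw [circleDeriv_sub_const] at hle
  have hpow := le_rpow_aTilde p hα (by nlinarith)
  refine ⟨hint, hle.trans ?_⟩
  gcongr
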